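/- Let $\mathbb K$ be a field of characteristic zero and let $H=\bigoplus_{i\ge 0}H_{(i)}$ be a connected graded Hopf algebra over $\mathbb K$ (product and coproduct respect the grading, $H_{(0)}=\mathbb K\mathbb I$, and the counit $\bar e$ vanishes on $H_{(i)}$ for $i\ge1$); for instance, $H$ may be the Hopf algebra $\mathcal H_F$ of Feynman graphs of a renormalizable quantum field theory. Let $A$ be a commutative unital $\mathbb K$-algebra with an idempotent $\mathbb K$-linear map $R:A\to A$ satisfying the Rota–Baxter relation $R(x)R(y)+R(xy)=R(R(x)y+xR(y))$, and put $\tilde R=\mathrm{id}-R$. Let $\mathcal A=\mathrm{Hom}(H,A)$ be the algebra of $\mathbb K$-linear maps with the convolution product $f\star g=m_A\circ(f\otimes g)\circ\Delta$ and unit $e=u_A\circ\bar e$, where $u_A:\mathbb K\to A$ is the unit map of $A$; let $\mathcal A_n$ be the subspace of maps vanishing on $H_{(i)}$ for all $i<n$, and let $\mathcal R(f)=R\circ f$, $\tilde{\mathcal R}(f)=\tilde R\circ f$. A character is a unital algebra homomorphism $H\to A$. Then: 1. $(\mathcal A,\mathcal R,\{\mathcal A_n\})$ is a complete filtered Rota–Baxter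 algebra: $\mathcal R$ satisfies the Rota–Baxter relation, $\mathcal A=\mathcal A_0\supseteq\mathcal A_1\supseteq\cdots$, $\mathcal A_m\star\mathcal A_n\subseteq\mathcal A_{m+n}$, $\mathcal R(\mathcal A_n)\subseteq\mathcal A_n$, and $\mathcal A$ is separated and complete in the topology of the filtration. Moreover $\mathcal R\circ\mathcal R=\mathcal R$. All elements of $e+\mathcal A_1$ are invertible, and the convergent series $\exp^\star(Z)=\sum_{n\ge0}Z^{\star n}/n!$ and $\log^\star(e+Z)=-\sum_{n\ge1}(-Z)^{\star n}/n$ define mutually inverse bijections between $\mathcal A_1$ and $e+\mathcal A_1$. 2. Every character $\phi$ lies in $e+\mathcal A_1$, and there are unique $\phi_-\in e+\mathcal R(\mathcal A_1)$ and $\phi_+\in e+\tilde{\mathcal R}(\mathcal A_1)$ with $\phi=\phi_-^{-1}\star\phi_+$. 3. The element $\phi_-$ is the unique solution in $\mathcal A$ of $X=e-\mathcal R(X\star(\phi-e))$, and $\phi_+$ is the unique solution in $\mathcal A$ of $X=e-\tilde{\mathcal R}(X\star(\phi^{-1}-e))$. For $\Gamma\in\ker\bar e$, $$\phi_-(\Gamma)=-R\Big(\phi(\Gamma)+\sum_{(\Gamma)}\phi_-(\Gamma')\phi(\Gamma'')\Big),\qquad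 \phi_+(\Gamma)=\tilde R\Big(\phi(\Gamma)+\sum_{(\Gamma)}\phi_-(\Gamma')\phi(\Gamma'')\Big),$$ where $\sum_{(\Gamma)}\Gamma'\otimes\Gamma''=\Delta(\Gamma)-\Gamma\otimes\mathbb I-\mathbb I\otimes\Gamma$. 4. There is a unique map $\chi:\mathcal A_1\to\mathcal A_1$ (the BCH-recursion, independent of $\phi$) such that for all $Z\in\mathcal A_1$ $$\chi(Z)=Z-\mathrm{BCH}\big(\mathcal R(\chi(Z)),\tilde{\mathcal R}(\chi(Z))\big),\qquad \mathrm{BCH}(x,y)=\log^\star(\exp^\star(x)\star\exp^\star(y))-x-y .$$ For every character $\phi$, with $Z=\log^\star(\phi)\in\mathcal A_1$, $$\phi_-=\exp^\star\big(-\mathcal R(\chi(Z))\big),\qquad \phi_+=\exp^\star\big(\tilde{\mathcal R}(\chi(Z))\big),$$ and both $\phi_-$ and $\phi_+$ are characters. -/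

import Mathlib

open TensorProduct

noncomputable section

/-! ### Rota-Baxter operators and complete filtered algebras -/

section Filtered

variable {K B : Type*} [Field K] [Ring B] [Algebra K B]

/-- The Rota-Baxter relation of weight one. -/
def IsRotaBaxter (T : B →ₗ[K] B) : Prop :=
  ∀ x y : B, T x * T y + T (x * y) = T (T x * y + x * T y)

/-- The complementary operator `id - T`. -/
def complOp (T : B →ₗ[K] B) : B →ₗ[K] B := LinearMap.id - T

/-- `(B, T, F)` is a complete filtered Rota-Baxter algebra: `T` is a Rota-Baxter operator, `F` is
a decreasing multiplicative filtration of `B` starting at `B` (so that every `F n` is a two-sided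
ideal), stable under `T`, and `B` is separated and complete for the topology in which the `F n`
form a basis of neighbourhoods of zero. -/
structure IsCompleteFilteredRotaBaxter (T : B →ₗ[K] B) (F : ℕ → Submodule K B) : Prop where
  rotaBaxter : IsRotaBaxter T
  zero_eq_top : F 0 = ⊤
  anti : Antitone F
  mul_mem : ∀ {m n : ℕ} {x y : B}, x ∈ F m → y ∈ F n → x * y ∈ F (m + n)
  map_mem : ∀ {n : ℕ} {x : B}, x ∈ F n → T x ∈ F n
  separated : ∀ x : B, (∀ n, x ∈ F n) → x = 0
  complete : ∀ u : ℕ → B, (∀ n, ∃ N, ∀ k ≥ N, ∀ l ≥ N, u k - u l ∈ F n) →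
    ∃ x, ∀ n, ∃ N, ∀ k ≥ N, u k - x ∈ F n

/-- The series `∑ u k` converges to `s` in the topology of the filtration `F`. -/
def HasFiltSum (F : ℕ → Submodule K B) (u : ℕ → B) (s : B) : Prop :=
  ∀ n, ∃ N, ∀ k ≥ N, (∑ i ∈ Finset.range k, u i) - s ∈ F n

open Classical in
/-- The sum of a series that converges in the topology of the filtration `F`
(and `0` if there is none). -/
def filtSum (F : ℕ → Submodule K B) (u : ℕ → B) : B :=
  if h : ∃ s, HasFiltSum F u s then h.choose else 0

/-- The terms `x ^ n / n!` of the exponential series. -/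
def expTerm (K : Type*) {B : Type*} [Field K] [Ring B] [Algebra K B] (x : B) (n : ℕ) : B :=
  ((n.factorial : K)⁻¹) • x ^ n

/-- The terms of the series `log (1 + x) = - ∑_{n ≥ 1} (-x) ^ n / n`, indexed from `0`. -/
def logTerm (K : Type*) {B : Type*} [Field K] [Ring B] [Algebra K B] (x : B) (n : ℕ) : B :=
  -((((n + 1 : ℕ) : K)⁻¹) • (-x) ^ (n + 1))

/-- The exponential of an element of `F 1`. -/
def filtExp (F : ℕ → Submodule K B) (x : B) : B := filtSum F (expTerm K x)

/-- The logarithm of an element of `1 + F 1`. -/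
def filtLog (F : ℕ → Submodule K B) (u : B) : B := filtSum F (logTerm K (u - 1))

/-- The Baker-Campbell-Hausdorff term: `exp x * exp y = exp (x + y + BCH x y)`. -/
def filtBCH (F : ℕ → Submodule K B) (x y : B) : B :=
  filtLog F (filtExp F x * filtExp F y) - x - y

/-- The functional equation `χ(Z) = Z - BCH(T(χ(Z)), (id - T)(χ(Z)))` of the BCH-recursion,
for a map `χ` from `F 1` to itself. -/
def IsBCHRecursion (T : B →ₗ[K] B) (F : ℕ → Submodule K B) (χ : F 1 → F 1) : Prop :=
  ∀ Z : F 1, (χ Z : B) = Z - filtBCH F (T (χ Z)) (complOp T (χ Z))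

/-- The set `1 + T (F 1)`. -/
def onePlusImage (T : B →ₗ[K] B) (F : ℕ → Submodule K B) : Set B :=
  {x | ∃ f ∈ F 1, x = 1 + T f}

/-- `φ = φm⁻¹ * φp` with `φm ∈ 1 + T (F 1)` and `φp ∈ 1 + (id - T) (F 1)`. -/
def IsBirkhoff (T : B →ₗ[K] B) (F : ℕ → Submodule K B) (φ φm φp : B) : Prop :=
  φm ∈ onePlusImage T F ∧ φp ∈ onePlusImage (complOp T) F ∧ φ = Ring.inverse φm * φp

end Filtered

/-! ### Connected graded Hopf algebras and the convolution algebra `Hom(H, A)` -/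

section Hopf

variable {K H : Type*} [Field K] [Ring H] [HopfAlgebra K H]

/-- A Hopf algebra with an algebra grading `𝓗` is connected graded if the coproduct respects the
grading, the degree zero part consists of the scalars, and the counit vanishes in positive
degrees. -/
structure IsConnectedGraded (𝓗 : ℕ → Submodule K H) [GradedAlgebra 𝓗] : Prop where
  comul_mem : ∀ (n : ℕ), ∀ x ∈ 𝓗 n, Coalgebra.comul (R := K) x ∈
    ⨆ (i : ℕ) (j : ℕ) (_ : i + j = n),
      LinearMap.range (TensorProduct.map (𝓗 i).subtype (𝓗 j).subtype)
  zero_eq : 𝓗 0 = Submodule.span K {1}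
  counit_eq_zero : ∀ (n : ℕ), 0 < n → ∀ x ∈ 𝓗 n, Coalgebra.counit (R := K) x = 0

/-- The reduced coproduct `Δ(x) - x ⊗ 1 - 1 ⊗ x`, i.e. the sum `∑ x' ⊗ x''` over the proper
parts. -/
def reducedComul (K : Type*) {H : Type*} [Field K] [Ring H] [HopfAlgebra K H] (x : H) :
    H ⊗[K] H :=
  Coalgebra.comul (R := K) x - x ⊗ₜ[K] 1 - 1 ⊗ₜ[K] x

variable {A : Type*} [CommRing A] [Algebra K A]

/-- `Hom(H, A)` with the convolution product; its unit is `h ↦ ε(h) 1`. -/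
abbrev ConvHom (K H A : Type*) [Field K] [Ring H] [HopfAlgebra K H] [CommRing A] [Algebra K A] :=
  WithConv (H →ₗ[K] A)

/-- The operator `f ↦ R ∘ f` on `Hom(H, A)`. -/
def postComp (H : Type*) [Ring H] [HopfAlgebra K H] (R : A →ₗ[K] A) :
    ConvHom K H A →ₗ[K] ConvHom K H A where
  toFun f := WithConv.toConv (R ∘ₗ f.ofConv)
  map_add' f g := by ext x; simp
  map_smul' c f := by ext x; simp

/-- The `n`-th step of the filtration of `Hom(H, A)`: the maps that vanish in degrees `< n`. -/
def homFiltration (A : Type*) [CommRing A] [Algebra K A] (𝓗 : ℕ → Submodule K H) (n : ℕ) :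
    Submodule K (ConvHom K H A) where
  carrier := {f | ∀ i < n, ∀ x ∈ 𝓗 i, f x = 0}
  add_mem' {f g} hf hg i hi x hx := by simp [hf i hi x hx, hg i hi x hx]
  zero_mem' i hi x hx := by simp
  smul_mem' c f hf i hi x hx := by simp [hf i hi x hx]

/-- `A`-valued characters: the linear maps that are unital algebra homomorphisms. -/
def IsCharacter (φ : ConvHom K H A) : Prop :=
  φ 1 = 1 ∧ ∀ x y : H, φ (x * y) = φ x * φ y

/-- The Sweedler-type sum `∑ f(x') g(x'')` over the reduced coproduct of `x`. -/
def reducedConv (f g : ConvHom K H A) (x : H) : A :=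
  LinearMap.mul' K A (TensorProduct.map f.ofConv g.ofConv (reducedComul K x))

end Hopf

end

noncomputable section

/-! ### Identities between formal power series -/

section PowerSeriesIdentities

open PowerSeries

variable (K : Type*) [Field K] [Algebra ℚ K]

/-! Evaluation of formal power series at `z ∈ F 1` respects products and substitution, so all facts
about `filtExp` and `filtLog` at a single element come from identities in `K⟦X⟧`.

The element `log (exp x * exp y)` varies like `x + y` up to one further filtration step. As `T` and
`complOp T` add up to the identity, `c ↦ Z - BCH(T c, complOp T c)` is therefore a contraction on `F
1`, and its fixed point is `χ(Z)` (`bch_contracting`, `exists_isBCHRecursion`). The recursion then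
says `exp (T c) * exp (complOp T c) = exp Z` for `c = χ(Z)`. For an idempotent Rota-Baxter operator
the images of `T` and `complOp T` are closed under products and limits, so these exponentials are
Birkhoff factors (`isBirkhoff_exp`).

Conversely, applying `T` to `φm * (φ - 1) = φp - φm` shows that any first factor solves Bogoliubov's
equation, which has at most one solution; this gives uniqueness. The same uniqueness on `H ⊗ H`
gives multiplicativity: for a character `φ`, the maps `φm (x * y)` and `φm x * φm y` are first
factors of the same map (`isCharacter_of_isBirkhoff`). -/

theorem PowerSeries.log_subst_exp_sub_one : (log K).subst (exp K - 1) = X := by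
  have : CharZero K := algebraRat.charZero K
  have hs : HasSubst (exp K - 1) := HasSubst.exp_sub_one
  refine derivative.ext ?_ ?_
  · rw [derivative_subst hs, map_sub, derivative_exp, derivative_X, deriv_log]
    -- The derivative of `log` is the inverse of `1 + X`; substituting `exp - 1` makes it the
    -- inverse of `exp`, so the chain rule gives derivative `1`.
    have h : (mk fun n ↦ algebraMap ℚ K ((-1 : ℚ) ^ n)) * (1 + X) = 1 := by
      ext n
      cases n with
      | zero => simp [mul_add]
      | succ n => simp [mul_add, coeff_succ_mul_X, pow_succ, coeff_one]
    have h2 := congrArg (fun f : K⟦X⟧ => f.subst (exp K - 1)) h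
    simp only [subst_mul hs, subst_add hs, subst_X hs] at h2
    have h1 : (1 : K⟦X⟧).subst (exp K - 1) = 1 := by
      rw [← coe_substAlgHom hs, map_one]
    rw [h1] at h2
    simpa using h2
  · rw [constantCoeff_X]
    exact constantCoeff_subst_eq_zero (by simp [← PowerSeries.constantCoeff_eq]) _
      constantCoeff_log

/-- A left compositional inverse of `exp - 1` agrees with its right inverse `Q`, so the previous
identity also yields the reverse composition. -/
theorem PowerSeries.exp_subst_log : (exp K).subst (log K) = 1 + X := by
  have hs : HasSubst (log K) := HasSubst.log
  have hE : (exp K - 1).constantCoeff = 0 := by simp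
  have hE' : IsUnit ((exp K - 1).coeff 1) := by simp [coeff_one]
  set Q := (exp K - 1).substInvOfIsUnit hE' with hQ
  have hQs : HasSubst Q := HasSubst.substInvOfIsUnit _ _
  have hlog : log K = Q := by
    have h := subst_comp_subst_apply (R := K) (HasSubst.exp_sub_one (A := K)) hQs (log K)
    rw [log_subst_exp_sub_one, subst_substInvOfIsUnit_right _ hE hE', X_subst, subst_X hQs] at h
    exact h.symm
  have h := subst_substInvOfIsUnit_right _ hE hE'
  rw [← hQ, ← hlog, ← coe_substAlgHom hs, map_sub, map_one, coe_substAlgHom] at h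
  rw [← h]; ring

end PowerSeriesIdentities

/-! ### Evaluation of power series in a filtered algebra -/

section Filtered

open PowerSeries

variable {K B : Type*} [Field K] [Ring B] [Algebra K B]

/-- The power series `f`, evaluated at `z`, converges to `a` in the topology of the filtration. -/
def IsFiltEval (F : ℕ → Submodule K B) (z : B) (f : K⟦X⟧) (a : B) : Prop :=
  ∀ n, Polynomial.aeval z (trunc n f) - a ∈ F n

theorem IsFiltEval.sub_constantCoeff_mem {F : ℕ → Submodule K B} {z a : B} {f : K⟦X⟧}
    (ha : IsFiltEval F z f a) : a - algebraMap K B f.constantCoeff ∈ F 1 := by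
  have := neg_mem (ha 1)
  simpa [trunc_one_left] using this

namespace IsCompleteFilteredRotaBaxter

variable {T : B →ₗ[K] B} {F : ℕ → Submodule K B}

section

variable (h : IsCompleteFilteredRotaBaxter T F)
include h

theorem mul_left_mem {n : ℕ} (x : B) {y : B} (hy : y ∈ F n) : x * y ∈ F n := by
  simpa using h.mul_mem (m := 0) (x := x) (by simp [h.zero_eq_top]) hy

theorem mul_right_mem {n : ℕ} {x : B} (y : B) (hx : x ∈ F n) : x * y ∈ F n := by
  simpa using h.mul_mem (n := 0) (y := y) hx (by simp [h.zero_eq_top])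

theorem compl_map_mem {n : ℕ} {x : B} (hx : x ∈ F n) : complOp T x ∈ F n :=
  sub_mem hx (h.map_mem hx)

theorem pow_mem {z : B} (hz : z ∈ F 1) (n : ℕ) : z ^ n ∈ F n := by
  induction n with
  | zero => simp [h.zero_eq_top]
  | succ n ih => rw [pow_succ]; exact h.mul_mem ih hz

theorem eq_of_sub_mem {x y : B} (hxy : ∀ n, x - y ∈ F n) : x = y :=
  sub_eq_zero.mp (h.separated _ hxy)

theorem aeval_mem {z : B} (hz : z ∈ F 1) {n : ℕ} {p : Polynomial K}
    (hp : ∀ i < n, p.coeff i = 0) : Polynomial.aeval z p ∈ F n := by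
  rw [Polynomial.aeval_eq_sum_range]
  refine Submodule.sum_mem _ fun i _ => ?_
  rcases lt_or_ge i n with hi | hi
  · simp [hp i hi]
  · exact Submodule.smul_mem _ _ (h.anti hi (h.pow_mem hz i))

theorem aeval_trunc_sub_mem {z : B} (hz : z ∈ F 1) (f : K⟦X⟧) {n k : ℕ} (hk : n ≤ k) :
    Polynomial.aeval z (trunc k f) - Polynomial.aeval z (trunc n f) ∈ F n := by
  rw [← map_sub]
  refine h.aeval_mem hz fun i hi => ?_
  simp [coeff_trunc, hi, hi.trans_le hk]

theorem isFiltEval_unique {z a b : B} {f : K⟦X⟧} (ha : IsFiltEval F z f a)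
    (hb : IsFiltEval F z f b) : a = b :=
  h.eq_of_sub_mem fun n => by
    have := sub_mem (hb n) (ha n)
    rwa [sub_sub_sub_cancel_left] at this

theorem exists_isFiltEval {z : B} (hz : z ∈ F 1) (f : K⟦X⟧) : ∃ a, IsFiltEval F z f a := by
  obtain ⟨a, ha⟩ := h.complete (fun n => Polynomial.aeval z (trunc n f)) fun n =>
    ⟨n, fun k hk l hl => by
      have := sub_mem (h.aeval_trunc_sub_mem hz f hk) (h.aeval_trunc_sub_mem hz f hl)
      rwa [sub_sub_sub_cancel_right] at this⟩
  -- `IsFiltEval` asks for the explicit rate `F n` at truncation `n`; it holds because later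
  -- truncations change nothing modulo `F n`.
  refine ⟨a, fun n => ?_⟩
  obtain ⟨N, hN⟩ := ha n
  have := sub_mem (hN (max N n) (le_max_left _ _))
    (h.aeval_trunc_sub_mem hz f (le_max_right N n))
  simpa using this

theorem isFiltEval_coe {z : B} (hz : z ∈ F 1) (p : Polynomial K) :
    IsFiltEval F z (p : K⟦X⟧) (Polynomial.aeval z p) := fun n => by
  rw [← map_sub]
  exact h.aeval_mem hz fun i hi => by simp [coeff_trunc, hi]

theorem isFiltEval_mul {z a b : B} (hz : z ∈ F 1) {f g : K⟦X⟧} (ha : IsFiltEval F z f a)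
    (hb : IsFiltEval F z g b) : IsFiltEval F z (f * g) (a * b) := fun n => by
  have h1 : Polynomial.aeval z (trunc n (f * g) - trunc n f * trunc n g) ∈ F n := by
    refine h.aeval_mem hz fun i hi => ?_
    rw [Polynomial.coeff_sub, coeff_trunc, if_pos hi,
      coeff_mul_eq_coeff_trunc_mul_trunc f g hi, ← Polynomial.coe_mul, Polynomial.coeff_coe,
      sub_self]
  have h2 := h.mul_right_mem (Polynomial.aeval z (trunc n g)) (ha n)
  have h3 := h.mul_left_mem a (hb n)
  convert add_mem (add_mem h1 h2) h3 using 1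
  rw [map_sub, map_mul (Polynomial.aeval z), sub_mul, mul_sub]
  abel

/-- For polynomial `f` this follows from linearity and multiplicativity. In general only `trunc n f`
matters modulo `F n`, since `X ∣ g` makes `g ^ n` divisible by `X ^ n`. -/
theorem isFiltEval_subst {z w a : B} (hz : z ∈ F 1) {f g : K⟦X⟧} (hg : g.constantCoeff = 0)
    (hw : IsFiltEval F z g w) (ha : IsFiltEval F w f a) : IsFiltEval F z (f.subst g) a := by
  have hs : HasSubst g := HasSubst.of_constantCoeff_zero' hg
  have hpoly : ∀ p : Polynomial K,
      IsFiltEval F z ((p : K⟦X⟧).subst g) (Polynomial.aeval w p) := by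
    intro p
    rw [subst_coe hs]
    induction p using Polynomial.induction_on' with
    | add p q hp hq =>
      intro n
      have := add_mem (hp n) (hq n)
      rw [map_add, map_add, map_add, map_add, add_sub_add_comm]
      exact this
    | monomial k c =>
      have hk : IsFiltEval F z (g ^ k) (w ^ k) := by
        induction k with
        | zero => simpa using h.isFiltEval_coe hz 1
        | succ k ih => rw [pow_succ, pow_succ]; exact h.isFiltEval_mul hz ih hw
      intro n
      rw [Polynomial.aeval_monomial, Polynomial.aeval_monomial, ← Algebra.smul_def,
        ← Algebra.smul_def, map_smul, map_smul, ← smul_sub]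
      exact Submodule.smul_mem _ _ (hk n)
  intro n
  have h1 : trunc n (f.subst g) = trunc n (((trunc n f : Polynomial K) : K⟦X⟧).subst g) := by
    have hd : f.subst g = g ^ n * (PowerSeries.mk fun i => coeff (i + n) f).subst g
        + ((trunc n f : Polynomial K) : K⟦X⟧).subst g := by
      conv_lhs => rw [eq_X_pow_mul_shift_add_trunc n f]
      rw [subst_add hs, subst_mul hs, subst_pow hs, subst_X hs]
    obtain ⟨g', rfl⟩ := X_dvd_iff.mpr hg
    ext i
    rw [coeff_trunc, coeff_trunc]
    split_ifs with hi
    · rw [hd, map_add, mul_pow, mul_assoc, coeff_X_pow_mul', if_neg (by omega), zero_add]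
    · rfl
  rw [h1]
  have := add_mem (hpoly (trunc n f) n) (ha n)
  simpa using this

/-- First-order Taylor estimate without commutativity: in the telescoped `z ^ k - z' ^ k` with `k ≥
2`, every term has an extra factor from `F 1`. -/
theorem isFiltEval_sub_mem {z z' a a' : B} (hz : z ∈ F 1) (hz' : z' ∈ F 1) {n : ℕ}
    (hzz : z - z' ∈ F n) {f : K⟦X⟧} (ha : IsFiltEval F z f a) (ha' : IsFiltEval F z' f a') :
    a - a' - coeff 1 f • (z - z') ∈ F (n + 1) := by
  have hpow : ∀ k, z ^ k - z' ^ k ∈ F n := by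
    intro k
    induction k with
    | zero => simp
    | succ k ih =>
      have := add_mem (h.mul_left_mem (z ^ k) hzz) (h.mul_right_mem z' ih)
      convert this using 1
      rw [pow_succ, pow_succ, mul_sub, sub_mul]; abel
  have hpow2 : ∀ k, z ^ (k + 2) - z' ^ (k + 2) ∈ F (n + 1) := by
    intro k
    have h1 : z ^ (k + 1) * (z - z') ∈ F (n + 1) :=
      h.anti (by omega) (h.mul_mem (h.pow_mem hz (k + 1)) hzz)
    have := add_mem h1 (h.mul_mem (hpow (k + 1)) hz')
    convert this using 1
    rw [pow_succ z (k + 1), pow_succ z' (k + 1), mul_sub, sub_mul]; abel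
  have hpoly : ∀ p : Polynomial K,
      Polynomial.aeval z p - Polynomial.aeval z' p - p.coeff 1 • (z - z') ∈ F (n + 1) := by
    intro p
    induction p using Polynomial.induction_on' with
    | add p q hp hq =>
      convert add_mem hp hq using 1
      rw [map_add, map_add, Polynomial.coeff_add, add_smul]; abel
    | monomial k c =>
      rw [Polynomial.aeval_monomial, Polynomial.aeval_monomial, ← Algebra.smul_def,
        ← Algebra.smul_def]
      match k with
      | 0 => simp
      | 1 => simp [smul_sub]
      | k + 2 =>
        rw [Polynomial.coeff_monomial, if_neg (by omega), zero_smul, sub_zero, ← smul_sub]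
        exact Submodule.smul_mem _ _ (hpow2 k)
  -- Truncating at `n + 2` rather than `n + 1` keeps the linear coefficient even for `n = 0`.
  have h1 := sub_mem (add_mem (hpoly (trunc (n + 2) f)) (h.anti (Nat.le_succ _) (ha' (n + 2))))
    (h.anti (Nat.le_succ _) (ha (n + 2)))
  rw [coeff_trunc, if_pos (by omega)] at h1
  convert h1 using 1
  abel

theorem isFiltEval_one_add_X {z : B} (hz : z ∈ F 1) :
    IsFiltEval F z (1 + X : K⟦X⟧) (1 + z) := by
  have := h.isFiltEval_coe hz (1 + Polynomial.X)
  rwa [Polynomial.coe_add, Polynomial.coe_one, Polynomial.coe_X, map_add, map_one,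
    Polynomial.aeval_X] at this

theorem isFiltEval_one {z : B} (hz : z ∈ F 1) : IsFiltEval F z (1 : K⟦X⟧) 1 := by
  have := h.isFiltEval_coe hz 1
  rwa [Polynomial.coe_one, map_one] at this

theorem isFiltEval_X {z : B} (hz : z ∈ F 1) : IsFiltEval F z (X : K⟦X⟧) z := by
  have := h.isFiltEval_coe hz Polynomial.X
  rwa [Polynomial.coe_X, Polynomial.aeval_X] at this

theorem isFiltEval_neg_X {z : B} (hz : z ∈ F 1) : IsFiltEval F z (-X : K⟦X⟧) (-z) := by
  have := h.isFiltEval_coe hz (-Polynomial.X)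
  rwa [Polynomial.coe_neg, Polynomial.coe_X, map_neg, Polynomial.aeval_X] at this

/-! ### Exponential and logarithm -/

theorem filtSum_eq {u : ℕ → B} {s : B} (hs : HasFiltSum F u s) : filtSum F u = s := by
  have hex : ∃ s, HasFiltSum F u s := ⟨s, hs⟩
  rw [filtSum, dif_pos hex]
  refine h.eq_of_sub_mem fun n => ?_
  obtain ⟨N, hN⟩ := hex.choose_spec n
  obtain ⟨M, hM⟩ := hs n
  have := sub_mem (hM _ (le_max_right N M)) (hN _ (le_max_left N M))
  rwa [sub_sub_sub_cancel_left] at this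

/-- The shift `m` is `0` for `exp` and `1` for `log`, whose terms start at the first power. -/
theorem hasFiltSum_of_isFiltEval {z a : B} {f : K⟦X⟧} (ha : IsFiltEval F z f a) {u : ℕ → B}
    {m : ℕ} (hu : ∀ k, ∑ i ∈ Finset.range k, u i = Polynomial.aeval z (trunc (k + m) f)) :
    HasFiltSum F u a := fun n =>
  ⟨n, fun k hk => by rw [hu]; exact h.anti (by omega) (ha (k + m))⟩

theorem isUnit_one_add {z : B} (hz : z ∈ F 1) : IsUnit (1 + z) := by
  have h1 := h.isFiltEval_one_add_X hz
  have h0 := h.isFiltEval_one hz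
  obtain ⟨b, hb⟩ := h.exists_isFiltEval hz (1 + X : K⟦X⟧)⁻¹
  have hne : constantCoeff (1 + X : K⟦X⟧) ≠ 0 := by simp
  have h2 := h.isFiltEval_mul hz h1 hb
  have h3 := h.isFiltEval_mul hz hb h1
  rw [PowerSeries.mul_inv_cancel _ hne] at h2
  rw [PowerSeries.inv_mul_cancel _ hne] at h3
  exact ⟨⟨1 + z, b, h.isFiltEval_unique h2 h0, h.isFiltEval_unique h3 h0⟩, rfl⟩

section ExpLog

variable [Algebra ℚ K]

theorem exp_spec {z : B} (hz : z ∈ F 1) :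
    HasFiltSum F (expTerm K z) (filtExp F z) ∧ IsFiltEval F z (exp K) (filtExp F z) := by
  obtain ⟨a, ha⟩ := h.exists_isFiltEval hz (exp K)
  have hs : HasFiltSum F (expTerm K z) a := by
    refine h.hasFiltSum_of_isFiltEval (m := 0) ha fun k => ?_
    rw [Polynomial.aeval_def, add_zero, eval₂_trunc_eq_sum_range]
    refine Finset.sum_congr rfl fun i _ => ?_
    rw [← Algebra.smul_def, coeff_exp, expTerm]
    simp
  have : filtExp F z = a := h.filtSum_eq hs
  rw [this]
  exact ⟨hs, ha⟩

theorem log_spec {z : B} (hz : z ∈ F 1) :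
    HasFiltSum F (logTerm K z) (filtLog F (1 + z)) ∧
      IsFiltEval F z (log K) (filtLog F (1 + z)) := by
  obtain ⟨a, ha⟩ := h.exists_isFiltEval hz (log K)
  have hs : HasFiltSum F (logTerm K z) a := by
    refine h.hasFiltSum_of_isFiltEval (m := 1) ha fun k => ?_
    rw [Polynomial.aeval_def, eval₂_trunc_eq_sum_range, Finset.sum_range_succ']
    simp only [coeff_log, if_pos, map_zero, zero_mul, add_zero]
    refine Finset.sum_congr rfl fun i _ => ?_
    rw [← Algebra.smul_def, if_neg (by omega), logTerm, ← neg_one_smul K z, smul_pow, smul_smul,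
      ← neg_smul]
    congr 1
    push_cast
    simp [pow_succ]
    ring
  have : filtLog F (1 + z) = a := by
    rw [filtLog, add_sub_cancel_left]; exact h.filtSum_eq hs
  rw [this]
  exact ⟨hs, ha⟩

theorem exp_sub_one_mem {z : B} (hz : z ∈ F 1) : filtExp F z - 1 ∈ F 1 := by
  simpa using (h.exp_spec hz).2.sub_constantCoeff_mem

theorem log_mem {z : B} (hz : z ∈ F 1) : filtLog F (1 + z) ∈ F 1 := by
  simpa using (h.log_spec hz).2.sub_constantCoeff_mem

theorem log_exp {z : B} (hz : z ∈ F 1) : filtLog F (filtExp F z) = z := by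
  have h1 : IsFiltEval F z (exp K - 1) (filtExp F z - 1) := fun n => by
    have := sub_mem ((h.exp_spec hz).2 n) (h.isFiltEval_one hz n)
    simpa [sub_sub_sub_comm] using this
  have h2 := (h.log_spec (h.exp_sub_one_mem hz)).2
  rw [add_sub_cancel] at h2
  have h3 := h.isFiltEval_subst hz (by simp) h1 h2
  rw [log_subst_exp_sub_one] at h3
  exact h.isFiltEval_unique h3 (h.isFiltEval_X hz)

theorem exp_log {z : B} (hz : z ∈ F 1) : filtExp F (filtLog F (1 + z)) = 1 + z := by
  have h3 := h.isFiltEval_subst hz constantCoeff_log (h.log_spec hz).2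
    (h.exp_spec (h.log_mem hz)).2
  rw [exp_subst_log] at h3
  exact h.isFiltEval_unique h3 (h.isFiltEval_one_add_X hz)

theorem exp_mul_exp_neg {z : B} (hz : z ∈ F 1) : filtExp F z * filtExp F (-z) = 1 := by
  have h1 := h.isFiltEval_neg_X hz
  have h2 := h.isFiltEval_mul hz (h.exp_spec hz).2
    (h.isFiltEval_subst hz (by simp) h1 (h.exp_spec (neg_mem hz)).2)
  have h3 : (exp K).subst (-X : K⟦X⟧) = evalNegHom (exp K) := by
    rw [evalNegHom, rescale_eq_subst]; simp
  rw [h3, exp_mul_exp_neg_eq_one] at h2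
  exact h.isFiltEval_unique h2 (h.isFiltEval_one hz)

theorem exp_neg_mul_exp {z : B} (hz : z ∈ F 1) : filtExp F (-z) * filtExp F z = 1 := by
  simpa using h.exp_mul_exp_neg (neg_mem hz)

theorem inverse_exp_neg {z : B} (hz : z ∈ F 1) : Ring.inverse (filtExp F (-z)) = filtExp F z :=
  Ring.inverse_unit ⟨filtExp F (-z), filtExp F z, h.exp_neg_mul_exp hz, h.exp_mul_exp_neg hz⟩

theorem exp_mul_exp_sub_one_mem {x y : B} (hx : x ∈ F 1) (hy : y ∈ F 1) :
    filtExp F x * filtExp F y - 1 ∈ F 1 := by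
  convert add_mem (h.mul_right_mem (filtExp F y) (h.exp_sub_one_mem hx)) (h.exp_sub_one_mem hy)
    using 1
  rw [sub_mul, one_mul]; abel

theorem exp_sub_exp_mem {x x' : B} (hx : x ∈ F 1) (hx' : x' ∈ F 1) {n : ℕ} (hn : x - x' ∈ F n) :
    filtExp F x - filtExp F x' - (x - x') ∈ F (n + 1) := by
  simpa using h.isFiltEval_sub_mem hx hx' hn (h.exp_spec hx).2 (h.exp_spec hx').2

theorem log_sub_log_mem {u u' : B} (hu : u - 1 ∈ F 1) (hu' : u' - 1 ∈ F 1) {n : ℕ}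
    (hn : u - u' ∈ F n) : filtLog F u - filtLog F u' - (u - u') ∈ F (n + 1) := by
  have h1 := (h.log_spec hu).2
  have h2 := (h.log_spec hu').2
  rw [add_sub_cancel] at h1 h2
  simpa using h.isFiltEval_sub_mem hu hu' (by simpa using hn) h1 h2

theorem log_exp_mul_exp_sub_mem {x x' y y' : B} (hx : x ∈ F 1) (hx' : x' ∈ F 1) (hy : y ∈ F 1)
    (hy' : y' ∈ F 1) {n : ℕ} (hxn : x - x' ∈ F n) (hyn : y - y' ∈ F n) :
    filtLog F (filtExp F x * filtExp F y) - filtLog F (filtExp F x' * filtExp F y')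
      - ((x - x') + (y - y')) ∈ F (n + 1) := by
  have h1 := h.exp_sub_exp_mem hx hx' hxn
  have h2 := h.exp_sub_exp_mem hy hy' hyn
  have h3 : filtExp F x * filtExp F y - filtExp F x' * filtExp F y' - ((x - x') + (y - y'))
      ∈ F (n + 1) := by
    -- With `a = exp x`, `b = exp y`, `dx = x - x'`, `dy = y - y'`, the element is `(a - a' - dx) b
    -- + a' (b - b' - dy) + dx (b - 1) + (a' - 1) dy`.
    have e1 := h.mul_right_mem (filtExp F y) h1
    have e2 := h.mul_left_mem (filtExp F x') h2
    have e3 := h.mul_mem hxn (h.exp_sub_one_mem hy)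
    have e4 := h.mul_mem (h.exp_sub_one_mem hx') hyn
    rw [add_comm 1 n] at e4
    convert add_mem (add_mem e1 e2) (add_mem e3 e4) using 1
    noncomm_ring
  have h4 : filtExp F x * filtExp F y - filtExp F x' * filtExp F y' ∈ F n := by
    have := add_mem (h.anti (Nat.le_succ n) h3) (add_mem hxn hyn)
    rwa [sub_add_cancel] at this
  have h5 := h.log_sub_log_mem (h.exp_mul_exp_sub_one_mem hx hy)
    (h.exp_mul_exp_sub_one_mem hx' hy') h4
  convert add_mem h5 h3 using 1
  abel

end ExpLog

/-! ### The BCH-recursion -/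

theorem eq_of_contracting {Ψ : B → B} {m : ℕ}
    (hΨ : ∀ n ≥ m, ∀ x ∈ F m, ∀ y ∈ F m, x - y ∈ F n → Ψ x - Ψ y ∈ F (n + 1)) {x y : B}
    (hx : x ∈ F m) (hy : y ∈ F m) (hxf : Ψ x = x) (hyf : Ψ y = y) : x = y := by
  have key : ∀ n, x - y ∈ F (m + n) := by
    intro n
    induction n with
    | zero => exact sub_mem hx hy
    | succ n ih =>
      have := hΨ (m + n) (by omega) x hx y hy ih
      rwa [hxf, hyf] at this
  exact h.eq_of_sub_mem fun n => h.anti (by omega) (key n)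

/-- Banach's fixed point argument: the iterates of `Ψ` from `0` form a Cauchy sequence. -/
theorem exists_fixedPoint_of_contracting {Ψ : B → B} {m : ℕ} (hm : ∀ x ∈ F m, Ψ x ∈ F m)
    (hΨ : ∀ n ≥ m, ∀ x ∈ F m, ∀ y ∈ F m, x - y ∈ F n → Ψ x - Ψ y ∈ F (n + 1)) :
    ∃ x ∈ F m, Ψ x = x := by
  set u : ℕ → B := fun n => Ψ^[n] 0 with hu
  have hsucc : ∀ n, u (n + 1) = Ψ (u n) := fun n => Function.iterate_succ_apply' Ψ n 0
  have humem : ∀ n, u n ∈ F m := by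
    intro n
    induction n with
    | zero => exact zero_mem _
    | succ n ih => rw [hsucc]; exact hm _ ih
  have hstep : ∀ n, u (n + 1) - u n ∈ F (m + n) := by
    intro n
    induction n with
    | zero => exact sub_mem (humem _) (humem _)
    | succ n ih =>
      have := hΨ (m + n) (by omega) _ (humem (n + 1)) _ (humem n) ih
      rwa [← hsucc, ← hsucc] at this
  have htail : ∀ n k, n ≤ k → u k - u n ∈ F n := by
    intro n k hk
    induction k, hk using Nat.le_induction with
    | base => simp
    | succ k hk ih =>
      have := add_mem (h.anti (by omega : n ≤ m + k) (hstep k)) ih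
      rwa [sub_add_sub_cancel] at this
  obtain ⟨x, hx⟩ := h.complete u fun n => ⟨n, fun k hk l hl => by
    have := sub_mem (htail n k hk) (htail n l hl)
    rwa [sub_sub_sub_cancel_right] at this⟩
  have hxm : x ∈ F m := by
    obtain ⟨N, hN⟩ := hx m
    have := sub_mem (humem N) (hN N le_rfl)
    rwa [sub_sub_cancel] at this
  refine ⟨x, hxm, h.eq_of_sub_mem fun n => ?_⟩
  obtain ⟨N, hN⟩ := hx (max n m)
  have h1 := hΨ (max n m) (le_max_right _ _) _ (humem N) _ hxm (hN N le_rfl)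
  rw [← hsucc] at h1
  have h2 := sub_mem (hN (N + 1) (Nat.le_succ N)) (h.anti (Nat.le_succ _) h1)
  rw [sub_sub_sub_cancel_left] at h2
  exact h.anti (le_max_left _ _) h2

section BCH

variable [Algebra ℚ K]

/-- The terms subtracted in `filtBCH` cancel exactly the first-order variation of the logarithm. -/
theorem bch_contracting (Z : B) {x y : B} (hx : x ∈ F 1) (hy : y ∈ F 1) {n : ℕ}
    (hxy : x - y ∈ F n) :
    (Z - filtBCH F (T x) (complOp T x)) - (Z - filtBCH F (T y) (complOp T y)) ∈ F (n + 1) := by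
  have h1 := h.log_exp_mul_exp_sub_mem (h.map_mem hx) (h.map_mem hy) (h.compl_map_mem hx)
    (h.compl_map_mem hy) (by rw [← map_sub]; exact h.map_mem hxy)
    (by rw [← map_sub]; exact h.compl_map_mem hxy)
  convert neg_mem h1 using 1
  simp only [filtBCH, complOp, LinearMap.sub_apply, LinearMap.id_apply]
  abel

theorem filtBCH_mem {x y : B} (hx : x ∈ F 1) (hy : y ∈ F 1) : filtBCH F x y ∈ F 1 := by
  have := h.log_mem (h.exp_mul_exp_sub_one_mem hx hy)
  rw [add_sub_cancel] at this
  exact sub_mem (sub_mem this hx) hy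

theorem exists_isBCHRecursion : ∃ χ : F 1 → F 1, IsBCHRecursion T F χ ∧
    ∀ χ' : F 1 → F 1, IsBCHRecursion T F χ' → χ' = χ := by
  have hc : ∀ Z : B, ∀ n ≥ 1, ∀ x ∈ F 1, ∀ y ∈ F 1, x - y ∈ F n →
      (Z - filtBCH F (T x) (complOp T x)) - (Z - filtBCH F (T y) (complOp T y)) ∈ F (n + 1) :=
    fun Z n _ x hx y hy hxy => h.bch_contracting Z hx hy hxy
  have hex : ∀ Z : F 1, ∃ c ∈ F 1, (Z : B) - filtBCH F (T c) (complOp T c) = c := fun Z =>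
    h.exists_fixedPoint_of_contracting (fun x hx =>
      sub_mem Z.2 (h.filtBCH_mem (h.map_mem hx) (h.compl_map_mem hx))) (hc Z)
  choose c hcm hcf using hex
  refine ⟨fun Z => ⟨c Z, hcm Z⟩, fun Z => (hcf Z).symm, fun χ' hχ' => ?_⟩
  funext Z
  exact Subtype.ext (h.eq_of_contracting (hc Z) (χ' Z).2 (hcm Z) (hχ' Z).symm (hcf Z))

/-- The BCH-recursion says that `χ` inverts `c ↦ log (exp (T c) * exp (c - T c))`. -/
theorem exp_mul_exp_of_isBCHRecursion {χ : F 1 → F 1} (hχ : IsBCHRecursion T F χ) (Z : F 1) :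
    filtExp F (T (χ Z)) * filtExp F (complOp T (χ Z)) = filtExp F Z := by
  have hlog : filtLog F (filtExp F (T (χ Z)) * filtExp F (complOp T (χ Z))) = Z := by
    have e := hχ Z
    have e2 : complOp T (χ Z : B) = χ Z - T (χ Z) := rfl
    have e3 : T (χ Z : B) + complOp T (χ Z : B) = χ Z := by rw [e2, add_sub_cancel]
    -- The two subtracted terms add up to `χ Z`, which cancels against the left side of the
    -- recursion.
    rw [filtBCH, sub_sub, sub_sub_eq_add_sub, e3, eq_comm, sub_eq_iff_eq_add, add_comm (Z : B)] at e
    exact (add_left_cancel e).symm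
  have h1 := h.exp_log (h.exp_mul_exp_sub_one_mem (h.map_mem (χ Z).2) (h.compl_map_mem (χ Z).2))
  rwa [add_sub_cancel, hlog, eq_comm] at h1

end BCH

end

end IsCompleteFilteredRotaBaxter

end Filtered

/-! ### Idempotent Rota-Baxter operators and Birkhoff factorizations -/

section Birkhoff

variable {K B : Type*} [Field K] [Ring B] [Algebra K B] {T : B →ₗ[K] B} {F : ℕ → Submodule K B}

theorem IsRotaBaxter.compl (hT : IsRotaBaxter T) : IsRotaBaxter (complOp T) := fun x y => by
  have := hT x y
  simp only [complOp, LinearMap.sub_apply, LinearMap.id_apply, mul_sub, sub_mul, map_add,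
    map_sub] at this ⊢
  rw [eq_sub_of_add_eq this]
  abel

/-- The relation reads `x * y + T (x * y) = 2 T (x * y)`. Hence the image of an idempotent `T` is
closed under products. -/
theorem IsRotaBaxter.map_mul_of_fixed (hT : IsRotaBaxter T) {x y : B} (hx : T x = x)
    (hy : T y = y) : T (x * y) = x * y := by
  have := hT x y
  rw [hx, hy, map_add] at this
  exact (add_right_cancel this).symm

theorem complOp_idem (hidem : ∀ x, T (T x) = T x) (x : B) :
    complOp T (complOp T x) = complOp T x := by
  simp [complOp, hidem]

theorem map_complOp (hidem : ∀ x, T (T x) = T x) (x : B) : T (complOp T x) = 0 := by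
  simp [complOp, hidem]

theorem complOp_complOp : complOp (complOp T) = T := by
  simp [complOp]

/-- The first factor of a Birkhoff factorization satisfies Bogoliubov's recursion. -/
theorem eq_one_sub_of_mem_onePlusImage (hidem : ∀ x, T (T x) = T x) {φ φm φp : B}
    (hm : φm ∈ onePlusImage T F) (hp : φp ∈ onePlusImage (complOp T) F) (hφ : φm * φ = φp) :
    φm = 1 - T (φm * (φ - 1)) := by
  obtain ⟨f, -, hf⟩ := hm
  obtain ⟨g, -, hg⟩ := hp
  have h1 : φm * (φ - 1) = complOp T g - T f := by
    rw [mul_sub, hφ, mul_one, hg, hf, add_sub_add_left_eq_sub]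
  rw [h1, map_sub, map_complOp hidem, hidem, zero_sub, sub_neg_eq_add, hf]

/-- Equations of the form `X = 1 - T (X * b)` have at most one solution if `b` is topologically
nilpotent. -/
theorem eq_of_eq_one_sub (h0 : F 0 = ⊤) (hsep : ∀ x : B, (∀ n, x ∈ F n) → x = 0)
    (hmul : ∀ (n : ℕ) (x y : B), x ∈ F n → y ∈ F 1 → x * y ∈ F (n + 1))
    (hmap : ∀ (n : ℕ) (x : B), x ∈ F n → T x ∈ F n) {b x y : B} (hb : b ∈ F 1)
    (hx : x = 1 - T (x * b)) (hy : y = 1 - T (y * b)) : x = y := by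
  refine sub_eq_zero.mp (hsep _ fun n => ?_)
  induction n with
  | zero => simp [h0]
  | succ n ih =>
    have h1 : x - y = -T ((x - y) * b) := by
      conv_lhs => rw [hx, hy]
      rw [sub_mul, map_sub]; abel
    rw [h1]
    exact neg_mem (hmap _ _ (hmul _ _ _ ih hb))

namespace IsCompleteFilteredRotaBaxter

variable (h : IsCompleteFilteredRotaBaxter T F)
include h

theorem compl : IsCompleteFilteredRotaBaxter (complOp T) F :=
  { h with
    rotaBaxter := h.rotaBaxter.compl
    map_mem := h.compl_map_mem }

theorem map_eq_of_isFiltEval {z a : B} {f : PowerSeries K} (hz : T z = z)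
    (hf : f.constantCoeff = 0) (ha : IsFiltEval F z f a) : T a = a := by
  have hpow : ∀ k, T (z ^ (k + 1)) = z ^ (k + 1) := by
    intro k
    induction k with
    | zero => simpa using hz
    | succ k ih => rw [pow_succ z (k + 1)]; exact h.rotaBaxter.map_mul_of_fixed ih hz
  have hpoly : ∀ p : Polynomial K, p.coeff 0 = 0 →
      T (Polynomial.aeval z p) = Polynomial.aeval z p := by
    intro p hp
    rw [Polynomial.aeval_eq_sum_range, map_sum]
    refine Finset.sum_congr rfl fun i _ => ?_
    cases i with
    | zero => simp [hp]
    | succ i => rw [map_smul, hpow]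
  refine h.eq_of_sub_mem fun n => ?_
  have h1 := sub_mem (ha n) (h.map_mem (ha n))
  rw [map_sub, hpoly _ (by simp [PowerSeries.coeff_trunc, hf])] at h1
  rwa [sub_sub_sub_cancel_left] at h1

theorem exp_mem_onePlusImage [Algebra ℚ K] {z : B} (hz : z ∈ F 1) (hTz : T z = z) :
    filtExp F z ∈ onePlusImage T F := by
  refine ⟨filtExp F z - 1, h.exp_sub_one_mem hz, ?_⟩
  have h1 : IsFiltEval F z (PowerSeries.exp K - 1) (filtExp F z - 1) := fun n => by
    have := sub_mem ((h.exp_spec hz).2 n) (h.isFiltEval_one hz n)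
    simpa [sub_sub_sub_comm] using this
  rw [h.map_eq_of_isFiltEval hTz (by simp) h1, add_sub_cancel]

theorem isUnit_of_mem_onePlusImage {x : B} (hx : x ∈ onePlusImage T F) : IsUnit x := by
  obtain ⟨f, hf, rfl⟩ := hx
  exact h.isUnit_one_add (h.map_mem hf)

theorem isUnit_of_sub_one_mem {x : B} (hx : x - 1 ∈ F 1) : IsUnit x := by
  simpa using h.isUnit_one_add hx

theorem mul_eq_of_isBirkhoff {φ φm φp : B} (hb : IsBirkhoff T F φ φm φp) : φm * φ = φp := by
  rw [hb.2.2, Ring.mul_inverse_cancel_left _ _ (h.isUnit_of_mem_onePlusImage hb.1)]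

theorem eq_iff_of_solution {b x : B} (hb : b ∈ F 1) (hx : x = 1 - T (x * b)) (y : B) :
    y = 1 - T (y * b) ↔ y = x :=
  ⟨fun hy => eq_of_eq_one_sub h.zero_eq_top h.separated (fun _ _ _ => h.mul_mem)
    (fun _ _ => h.map_mem) hb hy hx, fun hy => hy ▸ hx⟩

theorem inverse_sub_one_mem {φ : B} (hφ : φ - 1 ∈ F 1) : Ring.inverse φ - 1 ∈ F 1 := by
  have h1 : Ring.inverse φ - 1 = -(Ring.inverse φ * (φ - 1)) := by
    rw [mul_sub, Ring.inverse_mul_cancel _ (h.isUnit_of_sub_one_mem hφ), mul_one, neg_sub]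
  rw [h1]
  exact neg_mem (h.mul_left_mem _ hφ)

section

variable (hidem : ∀ x, T (T x) = T x) {φ φm φp : B} (hφ : φ - 1 ∈ F 1)
  (hb : IsBirkhoff T F φ φm φp)
include hidem hφ hb

theorem eq_left_iff_of_isBirkhoff (X : B) : X = 1 - T (X * (φ - 1)) ↔ X = φm :=
  h.eq_iff_of_solution hφ
    (eq_one_sub_of_mem_onePlusImage hidem hb.1 hb.2.1 (h.mul_eq_of_isBirkhoff hb)) X

/-- Since `φp * φ⁻¹ = φm`, the exchange of `T` with `complOp T` and of `φ` with `φ⁻¹` swaps the two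
factors. -/
theorem eq_right_iff_of_isBirkhoff (X : B) :
    X = 1 - complOp T (X * (Ring.inverse φ - 1)) ↔ X = φp := by
  refine h.compl.eq_iff_of_solution (h.inverse_sub_one_mem hφ)
    (eq_one_sub_of_mem_onePlusImage (complOp_idem hidem) hb.2.1 (by rw [complOp_complOp]; exact hb.1)
      ?_) X
  rw [← h.mul_eq_of_isBirkhoff hb,
    Ring.mul_inverse_cancel_right _ _ (h.isUnit_of_sub_one_mem hφ)]

theorem eq_of_isBirkhoff {ψm ψp : B} (hb' : IsBirkhoff T F φ ψm ψp) : ψm = φm ∧ ψp = φp := by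
  have hm := (h.eq_left_iff_of_isBirkhoff hidem hφ hb ψm).mp
    (eq_one_sub_of_mem_onePlusImage hidem hb'.1 hb'.2.1 (h.mul_eq_of_isBirkhoff hb'))
  exact ⟨hm, by rw [← h.mul_eq_of_isBirkhoff hb, ← h.mul_eq_of_isBirkhoff hb', hm]⟩

end

/-- The non-commutative Spitzer identity: the BCH-recursion yields a Birkhoff factorization. -/
theorem isBirkhoff_exp [Algebra ℚ K] (hidem : ∀ x, T (T x) = T x) {χ : F 1 → F 1}
    (hχ : IsBCHRecursion T F χ) (Z : F 1) :
    IsBirkhoff T F (filtExp F Z) (filtExp F (-T (χ Z))) (filtExp F (complOp T (χ Z))) := by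
  refine ⟨h.exp_mem_onePlusImage (neg_mem (h.map_mem (χ Z).2)) (by rw [map_neg, hidem]),
    h.compl.exp_mem_onePlusImage (h.compl_map_mem (χ Z).2) (complOp_idem hidem _), ?_⟩
  rw [h.inverse_exp_neg (h.map_mem (χ Z).2), h.exp_mul_exp_of_isBCHRecursion hχ]

end IsCompleteFilteredRotaBaxter

end Birkhoff

/-! ### The convolution algebra of a connected graded Hopf algebra -/

section Hopf

variable {K H A : Type*} [Field K] [Ring H] [HopfAlgebra K H] [CommRing A] [Algebra K A]
  {𝓗 : ℕ → Submodule K H}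

theorem IsConnectedGraded.map_comul_eq_zero [GradedAlgebra 𝓗] (h𝓗 : IsConnectedGraded 𝓗)
    {M : Type*} [AddCommGroup M] [Module K M] (L : H ⊗[K] H →ₗ[K] M) {n : ℕ}
    (hL : ∀ i j, i + j = n → ∀ x ∈ 𝓗 i, ∀ y ∈ 𝓗 j, L (x ⊗ₜ y) = 0) {x : H} (hx : x ∈ 𝓗 n) :
    L (Coalgebra.comul (R := K) x) = 0 := by
  have hle : (⨆ (i : ℕ) (j : ℕ) (_ : i + j = n),
      LinearMap.range (TensorProduct.map (𝓗 i).subtype (𝓗 j).subtype)) ≤ LinearMap.ker L := by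
    refine iSup_le fun i => iSup_le fun j => iSup_le fun hij => ?_
    rw [LinearMap.range_le_ker_iff]
    exact TensorProduct.ext' fun x y => hL i j hij x x.2 y y.2
  exact hle (h𝓗.comul_mem n x hx)

@[simp]
theorem postComp_apply (R : A →ₗ[K] A) (f : ConvHom K H A) (x : H) :
    postComp H R f x = R (f x) := rfl

theorem ConvHom.ext {f g : ConvHom K H A} (h : ∀ x, f x = g x) : f = g :=
  WithConv.ext (LinearMap.ext h)

theorem ConvHom.sub_apply (f g : ConvHom K H A) (x : H) : (f - g) x = f x - g x := rfl

theorem ConvHom.add_apply (f g : ConvHom K H A) (x : H) : (f + g) x = f x + g x := rfl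

/-- On pure tensors this is the relation for `R` at `f x` and `g y`; linearity extends it to `Δ(x)`.
-/
theorem isRotaBaxter_postComp {R : A →ₗ[K] A} (hR : IsRotaBaxter R) :
    IsRotaBaxter (postComp H R) := fun f g => by
  have key : ∀ t : H ⊗[K] H,
      LinearMap.mul' K A (TensorProduct.map (R ∘ₗ f.ofConv) (R ∘ₗ g.ofConv) t) +
        R (LinearMap.mul' K A (TensorProduct.map f.ofConv g.ofConv t)) =
      R (LinearMap.mul' K A (TensorProduct.map (R ∘ₗ f.ofConv) g.ofConv t) +
        LinearMap.mul' K A (TensorProduct.map f.ofConv (R ∘ₗ g.ofConv) t)) := by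
    intro t
    induction t with
    | zero => simp
    | tmul x y => simpa using hR (f x) (g y)
    | add s t hs ht =>
      simp only [map_add] at hs ht ⊢
      linear_combination hs + ht
  exact ConvHom.ext fun x => key (Coalgebra.comul (R := K) x)

/-- The maps on `H ⊗ H` that vanish in total degrees `< n`. -/
def tensorFiltration (A : Type*) [CommRing A] [Algebra K A] (𝓗 : ℕ → Submodule K H) (n : ℕ) :
    Submodule K (ConvHom K (H ⊗[K] H) A) where
  carrier := {f | ∀ i j, i + j < n → ∀ x ∈ 𝓗 i, ∀ y ∈ 𝓗 j, f (x ⊗ₜ y) = 0}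
  add_mem' {f g} hf hg i j hij x hx y hy := by simp [hf i j hij x hx y hy, hg i j hij x hx y hy]
  zero_mem' i j hij x hx y hy := by simp
  smul_mem' c f hf i j hij x hx y hy := by simp [hf i j hij x hx y hy]

/-- The map `x ⊗ y ↦ f (x * y)`. -/
def compMul (f : ConvHom K H A) : ConvHom K (H ⊗[K] H) A :=
  WithConv.toConv (f.ofConv ∘ₗ LinearMap.mul' K H)

/-- The map `x ⊗ y ↦ f x * g y`. -/
def boxMul (f g : ConvHom K H A) : ConvHom K (H ⊗[K] H) A :=
  WithConv.toConv (LinearMap.mul' K A ∘ₗ TensorProduct.map f.ofConv g.ofConv)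

/-- Multiplication `H ⊗ H → H` is a coalgebra map. -/
theorem compMul_mul (f g : ConvHom K H A) : compMul (f * g) = compMul f * compMul g :=
  WithConv.ext (LinearMap.convMul_comp_coalgHom_distrib f g (Bialgebra.mulCoalgHom K H))

/-- Multiplication `A ⊗ A → A` is an algebra map because `A` is commutative. -/
theorem boxMul_mul_boxMul (f g k l : ConvHom K H A) :
    boxMul f g * boxMul k l = boxMul (f * k) (g * l) := by
  have h := LinearMap.algHom_comp_convMul_distrib (Algebra.TensorProduct.lmul' K (S := A))
    (WithConv.toConv (TensorProduct.map f.ofConv g.ofConv))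
    (WithConv.toConv (TensorProduct.map k.ofConv l.ofConv))
  rw [TensorProduct.map_convMul_map] at h
  exact (WithConv.ext h).symm

theorem isCharacter_iff {f : ConvHom K H A} :
    IsCharacter f ↔ f 1 = 1 ∧ compMul f = boxMul f f := by
  refine and_congr_right fun _ => ⟨fun h => ?_, fun h x y => ?_⟩
  · exact WithConv.ext (TensorProduct.ext' h)
  · exact congrArg (fun k : ConvHom K (H ⊗[K] H) A => k (x ⊗ₜ y)) h

theorem boxMul_mem_onePlusImage {R : A →ₗ[K] A} (hR : IsRotaBaxter R)
    (hidem : ∀ a, R (R a) = R a) {f : ConvHom K H A}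
    (hf : f ∈ onePlusImage (postComp H R) (homFiltration A 𝓗)) :
    boxMul f f ∈ onePlusImage (postComp (H ⊗[K] H) R) (tensorFiltration A 𝓗) := by
  obtain ⟨g, hg, rfl⟩ := hf
  -- This `w` is fixed by composition with `R`, so it is its own preimage: the mixed terms with the
  -- counit are fixed by linearity, and `R (g x) * R (g y)` by the Rota-Baxter relation.
  let w : ConvHom K (H ⊗[K] H) A := boxMul (1 + postComp H R g) (1 + postComp H R g) - 1
  have hval : ∀ x y, w (x ⊗ₜ y) =
      algebraMap K A (Coalgebra.counit x) * R (g y) + R (g x) * algebraMap K A (Coalgebra.counit y)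
        + R (g x) * R (g y) := by
    intro x y
    change (algebraMap K A (Coalgebra.counit x) + R (g x)) *
        (algebraMap K A (Coalgebra.counit y) + R (g y)) -
      algebraMap K A (Coalgebra.counit (R := K) (x ⊗ₜ[K] y)) = _
    simp
    ring
  refine ⟨w, ?_, ?_⟩
  · intro i j hij x hx y hy
    rw [hval, hg i (by omega) x hx, hg j (by omega) y hy]
    simp
  · rw [← sub_eq_iff_eq_add']
    refine WithConv.ext (TensorProduct.ext' fun x y => ?_)
    change w (x ⊗ₜ y) =
      R (w (x ⊗ₜ y))
    rw [hval, map_add, map_add, hR.map_mul_of_fixed (hidem _) (hidem _),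
      mul_comm (R (g x)) (algebraMap K A _), ← Algebra.smul_def, ← Algebra.smul_def, map_smul,
      map_smul, hidem, hidem]

variable [GradedAlgebra 𝓗]

theorem mem_homFiltration_one_iff (h𝓗 : IsConnectedGraded 𝓗) {f : ConvHom K H A} :
    f ∈ homFiltration A 𝓗 1 ↔ f 1 = 0 := by
  constructor
  · intro hf
    exact hf 0 one_pos 1 SetLike.GradedOne.one_mem
  · intro hf i hi x hx
    obtain rfl : i = 0 := by omega
    rw [h𝓗.zero_eq, Submodule.mem_span_singleton] at hx
    obtain ⟨c, rfl⟩ := hx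
    simp [hf]

theorem homFiltration_mul_mem (h𝓗 : IsConnectedGraded 𝓗) {m n : ℕ} {f g : ConvHom K H A}
    (hf : f ∈ homFiltration A 𝓗 m) (hg : g ∈ homFiltration A 𝓗 n) :
    f * g ∈ homFiltration A 𝓗 (m + n) := by
  intro i hi x hx
  refine h𝓗.map_comul_eq_zero (LinearMap.mul' K A ∘ₗ TensorProduct.map f.ofConv g.ofConv)
    (fun a b hab x hx y hy => ?_) hx
  rw [LinearMap.comp_apply, TensorProduct.map_tmul, LinearMap.mul'_apply]
  rcases lt_or_ge a m with ha | ha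
  · rw [hf a ha x hx, zero_mul]
  · rw [hg b (by omega) y hy, mul_zero]

theorem homFiltration_separated (f : ConvHom K H A) (hf : ∀ n, f ∈ homFiltration A 𝓗 n) :
    f = 0 := by
  refine ConvHom.ext fun x => ?_
  induction x using DirectSum.Decomposition.inductionOn 𝓗 with
  | zero => simp
  | homogeneous x => exact hf _ _ (Nat.lt_succ_self _) _ x.2
  | add x y hx hy => rw [map_add, map_add, hx, hy]

theorem homFiltration_complete (u : ℕ → ConvHom K H A)
    (hu : ∀ n, ∃ N, ∀ k ≥ N, ∀ l ≥ N, u k - u l ∈ homFiltration A 𝓗 n) :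
    ∃ f, ∀ n, ∃ N, ∀ k ≥ N, u k - f ∈ homFiltration A 𝓗 n := by
  choose N hN using hu
  -- The limit is built degree by degree. In degree `i` the sequence is constant from `N (i + 1)`
  -- on, as step `i + 1` of the filtration is the first to control degree `i`.
  let f : H →ₗ[K] A := (DirectSum.toModule K ℕ A fun i => (u (N (i + 1))).ofConv ∘ₗ
    (𝓗 i).subtype) ∘ₗ (DirectSum.decomposeLinearEquiv 𝓗).toLinearMap
  have hf : ∀ i, ∀ x ∈ 𝓗 i, f x = u (N (i + 1)) x := by
    intro i x hx
    lift x to 𝓗 i using hx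
    simp [f, DirectSum.toModule_lof]
  refine ⟨WithConv.toConv f, fun n => ⟨(Finset.range n).sup fun i => N (i + 1), ?_⟩⟩
  intro k hk i hi x hx
  have hki : N (i + 1) ≤ k :=
    (Finset.le_sup (f := fun i => N (i + 1)) (Finset.mem_range.mpr hi)).trans hk
  have := hN (i + 1) k hki _ le_rfl i (Nat.lt_succ_self i) x hx
  rw [ConvHom.sub_apply] at this ⊢
  rw [← this]
  congr 1
  exact hf i x hx

theorem isCompleteFilteredRotaBaxter_postComp (h𝓗 : IsConnectedGraded 𝓗) {R : A →ₗ[K] A}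
    (hR : IsRotaBaxter R) :
    IsCompleteFilteredRotaBaxter (postComp H R) (homFiltration A 𝓗) where
  rotaBaxter := isRotaBaxter_postComp hR
  zero_eq_top := eq_top_iff.mpr fun _ _ _ hi => absurd hi (Nat.not_lt_zero _)
  anti _ _ hmn _ hf i hi := hf i (hi.trans_le hmn)
  mul_mem := homFiltration_mul_mem h𝓗
  map_mem hf i hi x hx := by rw [postComp_apply, hf i hi x hx, map_zero]
  separated := homFiltration_separated
  complete := homFiltration_complete

/-! ### Maps on the tensor square -/

theorem tensorFiltration_mul_mem (h𝓗 : IsConnectedGraded 𝓗) {m n : ℕ}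
    {f g : ConvHom K (H ⊗[K] H) A} (hf : f ∈ tensorFiltration A 𝓗 m)
    (hg : g ∈ tensorFiltration A 𝓗 n) : f * g ∈ tensorFiltration A 𝓗 (m + n) := by
  intro i j hij x hx y hy
  -- The coproduct of `H ⊗ H` is `Δ ⊗ Δ` followed by the middle swap; the grading is then used in
  -- one tensor factor at a time.
  let L : (H ⊗[K] H) ⊗[K] (H ⊗[K] H) →ₗ[K] A := LinearMap.mul' K A ∘ₗ
    TensorProduct.map f.ofConv g.ofConv ∘ₗ
    (TensorProduct.tensorTensorTensorComm K H H H H).toLinearMap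
  have hfg : (f * g) (x ⊗ₜ y) =
      L (Coalgebra.comul (R := K) x ⊗ₜ Coalgebra.comul (R := K) y) := rfl
  rw [hfg]
  refine h𝓗.map_comul_eq_zero (L ∘ₗ (TensorProduct.mk K _ _).flip (Coalgebra.comul (R := K) y))
    (fun a b hab x₁ hx₁ x₂ hx₂ => ?_) hx
  refine h𝓗.map_comul_eq_zero (L ∘ₗ TensorProduct.mk K _ _ (x₁ ⊗ₜ x₂))
    (fun c d hcd y₁ hy₁ y₂ hy₂ => ?_) hy
  have : (L ∘ₗ TensorProduct.mk K _ _ (x₁ ⊗ₜ x₂)) (y₁ ⊗ₜ y₂) =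
    f (x₁ ⊗ₜ y₁) * g (x₂ ⊗ₜ y₂) := rfl
  rw [this]
  rcases lt_or_ge (a + c) m with ha | ha
  · rw [hf a c ha x₁ hx₁ y₁ hy₁, zero_mul]
  · rw [hg b d (by omega) x₂ hx₂ y₂ hy₂, mul_zero]

theorem tensorFiltration_separated (f : ConvHom K (H ⊗[K] H) A)
    (hf : ∀ n, f ∈ tensorFiltration A 𝓗 n) : f = 0 := by
  refine WithConv.ext (TensorProduct.ext' fun x y => ?_)
  change f (x ⊗ₜ y) = 0
  induction x using DirectSum.Decomposition.inductionOn 𝓗 with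
  | zero => simp
  | add x x' hx hx' => rw [TensorProduct.add_tmul, map_add, hx, hx', add_zero]
  | homogeneous x =>
    induction y using DirectSum.Decomposition.inductionOn 𝓗 with
    | zero => simp
    | add y y' hy hy' => rw [TensorProduct.tmul_add, map_add, hy, hy', add_zero]
    | homogeneous y => exact hf _ _ _ (Nat.lt_succ_self _) _ x.2 _ y.2

theorem compMul_mem_onePlusImage {R : A →ₗ[K] A} {f : ConvHom K H A}
    (hf : f ∈ onePlusImage (postComp H R) (homFiltration A 𝓗)) :
    compMul f ∈ onePlusImage (postComp (H ⊗[K] H) R) (tensorFiltration A 𝓗) := by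
  obtain ⟨g, hg, rfl⟩ := hf
  refine ⟨compMul g, fun i j hij x hx y hy => ?_, ?_⟩
  · have hxy : x * y ∈ 𝓗 (i + j) := SetLike.GradedMul.mul_mem hx hy
    exact hg _ hij _ hxy
  · refine WithConv.ext (TensorProduct.ext' fun x y => ?_)
    change (algebraMap K A (Coalgebra.counit (x * y)) + R (g (x * y)) : A) =
      algebraMap K A (Coalgebra.counit (R := K) (x ⊗ₜ[K] y)) + R (g (x * y))
    simp [mul_comm]

theorem complOp_postComp (R : A →ₗ[K] A) : complOp (postComp H R) = postComp H (complOp R) := rfl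

theorem map_one_of_mem_onePlusImage (h𝓗 : IsConnectedGraded 𝓗) {R : A →ₗ[K] A}
    {f : ConvHom K H A} (hf : f ∈ onePlusImage (postComp H R) (homFiltration A 𝓗)) : f 1 = 1 := by
  obtain ⟨g, hg, rfl⟩ := hf
  rw [mem_homFiltration_one_iff h𝓗] at hg
  rw [ConvHom.add_apply, postComp_apply, hg]
  simp

/-- The factors of a character are characters: `x ⊗ y ↦ φm (x * y)` and `x ⊗ y ↦ φm x * φm y` are
both the first factor of the same map on `H ⊗ H`. -/
theorem isCharacter_of_isBirkhoff (h𝓗 : IsConnectedGraded 𝓗) {R : A →ₗ[K] A}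
    (hR : IsRotaBaxter R) (hidem : ∀ a, R (R a) = R a) {φ φm φp : ConvHom K H A}
    (hφ : IsCharacter φ) (hm : φm ∈ onePlusImage (postComp H R) (homFiltration A 𝓗))
    (hp : φp ∈ onePlusImage (complOp (postComp H R)) (homFiltration A 𝓗)) (hmul : φm * φ = φp) :
    IsCharacter φm ∧ IsCharacter φp := by
  rw [complOp_postComp] at hp
  have hR' : IsRotaBaxter (complOp R) := hR.compl
  have hidem' := complOp_idem hidem
  have hφ' := (isCharacter_iff.mp hφ).2
  have hT : ∀ f : ConvHom K (H ⊗[K] H) A,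
      postComp (H ⊗[K] H) R (postComp (H ⊗[K] H) R f) = postComp (H ⊗[K] H) R f :=
    fun f => ConvHom.ext fun x => hidem (f x)
  have h1 : compMul φm * compMul φ = compMul φp := by rw [← compMul_mul, hmul]
  have h2 : boxMul φm φm * compMul φ = boxMul φp φp := by rw [hφ', boxMul_mul_boxMul, hmul]
  have hb : compMul φ - 1 ∈ tensorFiltration A 𝓗 1 := by
    have hφ1 : φ - 1 ∈ homFiltration A 𝓗 1 := by
      rw [mem_homFiltration_one_iff h𝓗, ConvHom.sub_apply, hφ.1]
      simp
    intro i j hij x hx y hy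
    have := hφ1 (i + j) hij (x * y) (SetLike.GradedMul.mul_mem hx hy)
    rw [ConvHom.sub_apply] at this ⊢
    rw [← this]
    change φ (x * y) - algebraMap K A (Coalgebra.counit (R := K) (x ⊗ₜ[K] y)) =
      φ (x * y) - algebraMap K A (Coalgebra.counit (R := K) (x * y))
    simp [mul_comm]
  -- Only uniqueness of the solution is needed on `H ⊗ H`, so completeness of `tensorFiltration`
  -- plays no role.
  have e : compMul φm = boxMul φm φm :=
    eq_of_eq_one_sub (T := postComp (H ⊗[K] H) R) (F := tensorFiltration A 𝓗)
      (eq_top_iff.mpr fun _ _ _ _ hij => absurd hij (Nat.not_lt_zero _))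
      tensorFiltration_separated (fun _ _ _ => tensorFiltration_mul_mem h𝓗)
      (fun n f hf i j hij x hx y hy => by
        rw [postComp_apply, hf i j hij x hx y hy, map_zero]) hb
      (eq_one_sub_of_mem_onePlusImage hT (compMul_mem_onePlusImage hm)
        (compMul_mem_onePlusImage hp) h1)
      (eq_one_sub_of_mem_onePlusImage hT (boxMul_mem_onePlusImage hR hidem hm)
        (boxMul_mem_onePlusImage hR' hidem' hp) h2)
  refine ⟨isCharacter_iff.mpr ⟨map_one_of_mem_onePlusImage h𝓗 hm, e⟩,
    isCharacter_iff.mpr ⟨map_one_of_mem_onePlusImage h𝓗 hp, ?_⟩⟩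
  rw [← h1, e, h2]

/-- The terms `x ⊗ 1` and `1 ⊗ x` contribute `f x` and `g x`, so Bogoliubov's bracket is the
argument of the fixed point equation. -/
theorem add_reducedConv_eq {f g : ConvHom K H A} (hf : f 1 = 1) (hg : g 1 = 1) {x : H} :
    g x + reducedConv f g x = (f * (g - 1)) x := by
  rw [mul_sub, mul_one, ConvHom.sub_apply, LinearMap.convMul_apply, reducedConv, reducedComul,
    map_sub, map_sub, map_sub, map_sub, TensorProduct.map_tmul, TensorProduct.map_tmul,
    LinearMap.mul'_apply, LinearMap.mul'_apply, hf, hg]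
  ring

end Hopf

end

/-! ### Birkhoff factorization of characters -/

theorem theorem4p1 {K H A : Type*} [Field K] [CharZero K] [Ring H] [HopfAlgebra K H]
    [CommRing A] [Algebra K A] (𝓗 : ℕ → Submodule K H) [GradedAlgebra 𝓗]
    (h𝓗 : IsConnectedGraded 𝓗) (R : A →ₗ[K] A) (hR : IsRotaBaxter R)
    (hidem : ∀ a : A, R (R a) = R a) :
    -- the complete filtered Rota-Baxter algebra and its idempotent operator
    IsCompleteFilteredRotaBaxter (postComp H R) (homFiltration A 𝓗) ∧
    (∀ f : ConvHom K H A, postComp H R (postComp H R f) = postComp H R f) ∧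
    -- inverses, exponential and logarithm are well defined
    (∀ Z ∈ homFiltration A 𝓗 1,
      IsUnit (1 + Z) ∧
      HasFiltSum (homFiltration A 𝓗) (expTerm K Z) (filtExp (homFiltration A 𝓗) Z) ∧
      HasFiltSum (homFiltration A 𝓗) (logTerm K Z) (filtLog (homFiltration A 𝓗) (1 + Z)) ∧
      filtExp (homFiltration A 𝓗) Z - 1 ∈ homFiltration A 𝓗 1 ∧
      filtLog (homFiltration A 𝓗) (1 + Z) ∈ homFiltration A 𝓗 1 ∧
      filtLog (homFiltration A 𝓗) (filtExp (homFiltration A 𝓗) Z) = Z ∧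
      filtExp (homFiltration A 𝓗) (filtLog (homFiltration A 𝓗) (1 + Z)) = 1 + Z) ∧
    -- the BCH-recursion exists, is unique, and yields the factors below
    ∃ χ : homFiltration A 𝓗 1 → homFiltration A 𝓗 1,
      IsBCHRecursion (postComp H R) (homFiltration A 𝓗) χ ∧
      (∀ χ' : homFiltration A 𝓗 1 → homFiltration A 𝓗 1,
        IsBCHRecursion (postComp H R) (homFiltration A 𝓗) χ' → χ' = χ) ∧
      ∀ φ : ConvHom K H A, IsCharacter φ →
        φ - 1 ∈ homFiltration A 𝓗 1 ∧
        ∃ φm φp : ConvHom K H A,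
          -- existence and uniqueness of the factorization
          IsBirkhoff (postComp H R) (homFiltration A 𝓗) φ φm φp ∧
          (∀ ψm ψp : ConvHom K H A,
            IsBirkhoff (postComp H R) (homFiltration A 𝓗) φ ψm ψp → ψm = φm ∧ ψp = φp) ∧
          -- the factors are the solutions of the fixed point equations
          (∀ X : ConvHom K H A, X = 1 - postComp H R (X * (φ - 1)) ↔ X = φm) ∧
          (∀ X : ConvHom K H A,
            X = 1 - complOp (postComp H R) (X * (Ring.inverse φ - 1)) ↔ X = φp) ∧
          -- Bogoliubov's recursions on the augmentation ideal
          (∀ x : H, Coalgebra.counit (R := K) x = 0 →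
            φm x = -R (φ x + reducedConv φm φ x) ∧
            φp x = complOp R (φ x + reducedConv φm φ x)) ∧
          -- the non-commutative Spitzer identity, with `Z` the logarithm of `φ`
          (∃ hZ : filtLog (homFiltration A 𝓗) φ ∈ homFiltration A 𝓗 1,
            φm = filtExp (homFiltration A 𝓗)
              (-postComp H R (χ ⟨filtLog (homFiltration A 𝓗) φ, hZ⟩)) ∧
            φp = filtExp (homFiltration A 𝓗)
              (complOp (postComp H R) (χ ⟨filtLog (homFiltration A 𝓗) φ, hZ⟩))) ∧
          -- both factors are characters
          IsCharacter φm ∧ IsCharacter φp := by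
  have h := isCompleteFilteredRotaBaxter_postComp (A := A) h𝓗 hR
  have hT : ∀ f : ConvHom K H A, postComp H R (postComp H R f) = postComp H R f :=
    fun f => ConvHom.ext fun x => hidem (f x)
  obtain ⟨χ, hχ, hχu⟩ := h.exists_isBCHRecursion
  refine ⟨h, hT, fun Z hZ => ⟨h.isUnit_one_add hZ, (h.exp_spec hZ).1, (h.log_spec hZ).1,
    h.exp_sub_one_mem hZ, h.log_mem hZ, h.log_exp hZ, h.exp_log hZ⟩, χ, hχ, hχu,
    fun φ hφ => ?_⟩
  have hφ1 : φ - 1 ∈ homFiltration A 𝓗 1 := by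
    rw [mem_homFiltration_one_iff h𝓗, ConvHom.sub_apply, hφ.1]
    simp
  have hZ : filtLog (homFiltration A 𝓗) φ ∈ homFiltration A 𝓗 1 := by
    simpa using h.log_mem hφ1
  have hexp : filtExp (homFiltration A 𝓗) (filtLog (homFiltration A 𝓗) φ) = φ := by
    simpa using h.exp_log hφ1
  -- The factors are constructed from `χ`, so the Spitzer formulas below hold by definition.
  have hb := h.isBirkhoff_exp hT hχ ⟨_, hZ⟩
  rw [hexp] at hb
  have hmul := h.mul_eq_of_isBirkhoff hb
  have hchar := isCharacter_of_isBirkhoff h𝓗 hR hidem hφ hb.1 hb.2.1 hmul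
  have hm := (h.eq_left_iff_of_isBirkhoff hT hφ1 hb _).mpr rfl
  refine ⟨hφ1, _, _, hb, fun ψm ψp hψ => h.eq_of_isBirkhoff hT hφ1 hb hψ,
    h.eq_left_iff_of_isBirkhoff hT hφ1 hb, h.eq_right_iff_of_isBirkhoff hT hφ1 hb,
    fun x hx => ?_, ⟨hZ, rfl, rfl⟩, hchar.1, hchar.2⟩
  rw [add_reducedConv_eq hchar.1.1 hφ.1]
  generalize filtExp (homFiltration A 𝓗) (-(postComp H R) _) = φm at *
  generalize filtExp (homFiltration A 𝓗) (complOp (postComp H R) _) = φp at *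
  have e : φm x = -R ((φm * (φ - 1)) x) := by
    conv_lhs => rw [hm]
    rw [ConvHom.sub_apply, LinearMap.convOne_apply, hx, map_zero, zero_sub]
    rfl
  refine ⟨e, ?_⟩
  -- With `y` the bracket at `x`, `φm x = -R y` gives `φp x = y - R y`.
  have e2 : φp = φm + φm * (φ - 1) := by rw [mul_sub, mul_one, hmul, add_sub_cancel]
  rw [e2, ConvHom.add_apply, e, complOp, LinearMap.sub_apply, LinearMap.id_apply]
  abel
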